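/- An echeloned space is a pair $\mathbf X=(X,\leq_{\mathbf X})$, where $X$ is a non-empty set and $\leq_{\mathbf X}$ is a total preorder on $X^2$ such that for all $x,y,z\in X$: (i) $(x,x)\leq_{\mathbf X}(y,z)$; (ii) if $(y,z)\leq_{\mathbf X}(x,x)$ then $y=z$; (iii) $(x,y)\leq_{\mathbf X}(y,x)$. An embedding $\mathbf X\to\mathbf Y$ is an injective map $f\colon X\to Y$ such that $(x_1,y_1)\leq_{\mathbf X}(x_2,y_2)$ if and only if $(f(x_1),f(y_1))\leq_{\mathbf Y}(f(x_2),f(y_2))$ for all $x_1,y_1,x_2,y_2\in X$; an automorphism of $\mathbf X$ is a bijective embedding $\mathbf X\to\mathbf X$. Call $\mathbf X$ universal if every finite echeloned space embeds into $\mathbf X$, and homogeneous if every isomorphism between finite subspaces of $\mathbf X$ extends to an automorphism of $\mathbf X$. **Theorem.** A countable universal homogeneous echeloned space exists, and for every such space $\mathbf F=(F,\leq_{\mathbf F})$ the full symmetric group $\operatorname{Sym}(\mathbb N)$ topologically embeds into $\operatorname{Aut}(\mathbf F)$: there is a group homomorphism $\operatorname{Sym}(\mathbb N)\to\operatorname{Aut}(\mathbf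 F)$ that is a homeomorphism onto its image. Here both groups carry the topology of pointwise convergence, with $\mathbb N$ and $F$ regarded as discrete spaces. -/

import Mathlib

universe u v

/-- An echeloned space on the (non-empty) set `X`: a total preorder on `X × X` (the echelon) such
that diagonal pairs are below all pairs, only diagonal pairs are below diagonal pairs, and a pair
is below its reversal. -/
structure EchelonedSpace (X : Type u) where
  nonempty : Nonempty X
  le : X × X → X × X → Prop
  le_refl : ∀ p, le p p
  le_trans : ∀ p q r, le p q → le q r → le p r
  le_total : ∀ p q, le p q ∨ le q p
  diag_le : ∀ x y z, le (x, x) (y, z)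
  eq_of_le_diag : ∀ x y z, le (y, z) (x, x) → y = z
  le_swap : ∀ x y, le (x, y) (y, x)

namespace EchelonedSpace

/-- `f` is an embedding of echeloned spaces, i.e. an embedding of the associated relational
structures with one `4`-ary relation: it is injective, and it preserves and reflects the echelon. -/
def IsEmbedding {X : Type u} {Y : Type v} (S : EchelonedSpace X) (T : EchelonedSpace Y)
    (f : X → Y) : Prop :=
  Function.Injective f ∧
    ∀ x₁ y₁ x₂ y₂, S.le (x₁, y₁) (x₂, y₂) ↔ T.le (f x₁, f y₁) (f x₂, f y₂)

/-- The echeloned subspace induced on a non-empty subset. -/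
def induced {X : Type u} (S : EchelonedSpace X) (A : Set X) (hA : A.Nonempty) :
    EchelonedSpace A where
  nonempty := hA.to_subtype
  le p q := S.le (p.1, p.2) (q.1, q.2)
  le_refl _ := S.le_refl _
  le_trans _ _ _ := S.le_trans _ _ _
  le_total _ _ := S.le_total _ _
  diag_le _ _ _ := S.diag_le _ _ _
  eq_of_le_diag _ _ _ h := Subtype.ext (S.eq_of_le_diag _ _ _ h)
  le_swap _ _ := S.le_swap _ _

/-- The automorphism group of an echeloned space, as a subgroup of the full symmetric group. -/
def aut {X : Type u} (S : EchelonedSpace X) : Subgroup (Equiv.Perm X) where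
  carrier := {g | ∀ x₁ y₁ x₂ y₂, S.le (x₁, y₁) (x₂, y₂) ↔ S.le (g x₁, g y₁) (g x₂, g y₂)}
  mul_mem' {g h} hg hh x₁ y₁ x₂ y₂ := (hh x₁ y₁ x₂ y₂).trans (hg _ _ _ _)
  one_mem' _ _ _ _ := Iff.rfl
  inv_mem' {g} hg x₁ y₁ x₂ y₂ := by
    simpa using (hg (g⁻¹ x₁) (g⁻¹ y₁) (g⁻¹ x₂) (g⁻¹ y₂)).symm

/-- Universality (for finite echeloned spaces): every finite echeloned space embeds. -/
def IsUniversal {X : Type u} (S : EchelonedSpace X) : Prop :=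
  ∀ (A : Type) [Finite A] (B : EchelonedSpace A), ∃ f : A → X, IsEmbedding B S f

/-- Homogeneity: every isomorphism between finite subspaces, that is, every embedding of a finite
subspace into the whole space, extends to an automorphism. -/
def IsHomogeneous {X : Type u} (S : EchelonedSpace X) : Prop :=
  ∀ (A : Set X) (_ : A.Finite) (hA : A.Nonempty) (f : A → X),
    IsEmbedding (S.induced A hA) S f → ∃ g ∈ S.aut, ∀ a : A, g a = f a

end EchelonedSpace

/-- The topology of pointwise convergence on the full symmetric group of `X`, where `X` is
regarded as a discrete space. Subgroups such as `EchelonedSpace.aut` get the relative topology. -/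
instance permPointwiseTopology (X : Type u) : TopologicalSpace (Equiv.Perm X) :=
  TopologicalSpace.induced (fun (g : Equiv.Perm X) (x : X) => g x)
    (@Pi.topologicalSpace X (fun _ => X) (fun _ => ⊥))

/-!
An echeloned space is a complete graph whose edges are coloured by a linear order, where only the
order of the colours matters. Call a colouring `c : X → X → C` of a complete graph generic if every
one-point extension of a finite subset, with arbitrary colours, is realised in `X`
(`IsGenericColoring`). For countable `X`, back and forth shows that any two generic colourings with
the same colours are isomorphic, and that finite partial isomorphisms extend
(`IsGenericColoring.exists_equiv_extending`).

For countable non-empty `C` there is an explicit generic colouring, on the finite trees `ColorTree C` with leaves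
in `ℕ`: a tree is a finite list of colours prescribed for the edges to other (smaller) trees. The
symmetric group of `ℕ` acts on these trees by permuting leaves, and preserves the colouring.

*Existence.* With `C = ℚ` the trees form a universal echeloned space. It is homogeneous: an isomorphism
of finite subspaces induces a finite partial isomorphism of `ℚ`, which extends to an automorphism
`α` of `ℚ`, and then the isomorphism of subspaces extends to an isomorphism from the recolouring
along `α` to the original colouring.

*Embedding.* In a universal homogeneous space `F` colour each edge by its equivalence class. This
colouring is generic (`EchelonedSpace.isGenericColoring_pairColor`): enlarge the finite set so that the
prescribed colours occur in it, embed the one-point extension by universality, and move it into place by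
homogeneity. Hence, for countable `F`, the colouring is isomorphic to that on trees, and `Sym(ℕ)`
acts on `F` by automorphisms that fix all the colours. The action is continuous because a tree has
finitely many leaves, and its inverse is continuous because the trees that are single leaves form a
copy of `ℕ` with the natural action.
-/

/-! ### Back and forth -/

/-- Back and forth for a reflexive symmetric compatibility relation `R` on pairs `(x, y)`: if every
finite set of pairwise compatible pairs can be enlarged so as to meet any prescribed `x` or `y`, then
every such set extends to the graph of a bijection with pairwise compatible pairs. -/
theorem exists_equiv_of_back_and_forth {X : Type u} {Y : Type v} [Countable X] [Countable Y]
    (R : X × Y → X × Y → Prop) (refl : ∀ p, R p p) (symm : ∀ p q, R p q → R q p)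
    (inj : ∀ p q, R p q → (p.1 = q.1 ↔ p.2 = q.2))
    (forth : ∀ s : Finset (X × Y), (∀ p ∈ s, ∀ q ∈ s, R p q) → ∀ x, ∃ y, ∀ p ∈ s, R p (x, y))
    (back : ∀ s : Finset (X × Y), (∀ p ∈ s, ∀ q ∈ s, R p q) → ∀ y, ∃ x, ∀ p ∈ s, R p (x, y))
    (s₀ : Finset (X × Y)) (hs₀ : ∀ p ∈ s₀, ∀ q ∈ s₀, R p q) :
    ∃ e : X ≃ Y, (∀ p ∈ s₀, e p.1 = p.2) ∧ ∀ x x', R (x, e x) (x', e x') := by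
  classical
  let P := {s : Finset (X × Y) // ∀ p ∈ s, ∀ q ∈ s, R p q}
  have add (s : P) (r : X × Y) (hr : ∀ p ∈ s.1, R p r) : ∃ t : P, r ∈ t.1 ∧ s ≤ t := by
    refine ⟨⟨insert r s.1, ?_⟩, Finset.mem_insert_self _ _, Finset.subset_insert r s.1⟩
    intro p hp q hq
    rcases Finset.mem_insert.1 hp with rfl | hp' <;> rcases Finset.mem_insert.1 hq with rfl | hq'
    · exact refl _
    · exact symm _ _ (hr _ hq')
    · exact hr _ hp'
    · exact s.2 _ hp' _ hq'
  let D : X ⊕ Y → Order.Cofinal P := fun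
    | .inl x => ⟨{t | ∃ y, (x, y) ∈ t.1}, fun s => by
        obtain ⟨y, hy⟩ := forth s.1 s.2 x
        obtain ⟨t, h, hst⟩ := add s _ hy
        exact ⟨t, ⟨y, h⟩, hst⟩⟩
    | .inr y => ⟨{t | ∃ x, (x, y) ∈ t.1}, fun s => by
        obtain ⟨x, hx⟩ := back s.1 s.2 y
        obtain ⟨t, h, hst⟩ := add s _ hx
        exact ⟨t, ⟨x, h⟩, hst⟩⟩
  let : Encodable (X ⊕ Y) := Encodable.ofCountable _
  let I := Order.idealOfCofinals (⟨s₀, hs₀⟩ : P) D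
  have compat {p q : X × Y} (hp : ∃ s ∈ I, p ∈ s.1) (hq : ∃ s ∈ I, q ∈ s.1) : R p q := by
    obtain ⟨s, hs, hp⟩ := hp
    obtain ⟨t, ht, hq⟩ := hq
    obtain ⟨r, -, hsr, htr⟩ := I.directed s hs t ht
    exact r.2 _ (hsr hp) _ (htr hq)
  have hX (x : X) : ∃ y, ∃ s ∈ I, (x, y) ∈ s.1 := by
    obtain ⟨s, ⟨y, hy⟩, hs⟩ := Order.cofinal_meets_idealOfCofinals ⟨s₀, hs₀⟩ D (.inl x)
    exact ⟨y, s, hs, hy⟩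
  have hY (y : Y) : ∃ x, ∃ s ∈ I, (x, y) ∈ s.1 := by
    obtain ⟨s, ⟨x, hx⟩, hs⟩ := Order.cofinal_meets_idealOfCofinals ⟨s₀, hs₀⟩ D (.inr y)
    exact ⟨x, s, hs, hx⟩
  choose f hf using hX
  choose g hg using hY
  refine ⟨⟨f, g, fun x => ?_, fun y => ?_⟩, fun p hp => ?_, fun x x' => compat (hf x) (hf x')⟩
  · exact (inj _ _ (compat (hg (f x)) (hf x))).2 rfl
  · exact (inj _ _ (compat (hf (g y)) (hg y))).1 rfl
  · exact (inj _ _ (compat (hf p.1) ⟨_, Order.mem_idealOfCofinals ⟨s₀, hs₀⟩ D, hp⟩)).1 rfl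

/-- Every finite partial order isomorphism of `ℚ` extends to an automorphism. -/
theorem exists_orderIso_rat_extending (s : Finset (ℚ × ℚ))
    (hs : ∀ p ∈ s, ∀ q ∈ s, p.1 ≤ q.1 ↔ p.2 ≤ q.2) :
    ∃ α : ℚ ≃o ℚ, ∀ p ∈ s, α p.1 = p.2 := by
  have swap {a b c d : ℚ} (h : cmp a b = cmp c d) : cmp b a = cmp d c := by
    rw [← cmp_swap a b, ← cmp_swap c d, h]
  obtain ⟨e, he, h⟩ := exists_equiv_of_back_and_forth
    (fun p q : ℚ × ℚ => cmp p.1 q.1 = cmp p.2 q.2) (fun p => by simp) (fun p q h => swap h)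
    (fun p q h => by rw [← cmp_eq_eq_iff, h, cmp_eq_eq_iff])
    (fun s hs x => Order.PartialIso.exists_across ⟨s, hs⟩ x)
    (fun s hs y => by
      obtain ⟨x, hx⟩ := Order.PartialIso.exists_across (Order.PartialIso.comm ⟨s, hs⟩) y
      refine ⟨x, fun p hp => (hx (p.2, p.1) ?_).symm⟩
      simpa [Order.PartialIso.comm] using hp)
    s (fun p hp q hq => by
      simp [cmp, cmpUsing, ← not_le, hs p hp q hq, hs q hq p hp])
  exact ⟨⟨e, fun {a b} => (le_iff_le_of_cmp_eq_cmp (h a b)).symm⟩, he⟩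

/-! ### Generic colourings -/

/-- A colouring of the edges of the complete graph on `X` is generic if every one-point extension
of a finite subset, with arbitrary colours, is realised in `X`. The value of `c` on the diagonal
carries no information. -/
structure IsGenericColoring {X : Type u} {C : Type v} (c : X → X → C) : Prop where
  symm : ∀ x y, c x y = c y x
  exists_realization : ∀ (A : Finset X) (f : X → C), ∃ x ∉ A, ∀ a ∈ A, c x a = f a

namespace IsGenericColoring

universe w

variable {X : Type u} {Y : Type v} {C : Type w}

/-- The forth step: a finite partial isomorphism into a generic colouring can be enlarged so as to be
defined at a given point. -/
theorem exists_forth {c : X → X → C} {c' : Y → Y → C} (hc : ∀ x y, c x y = c y x)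
    (hc' : IsGenericColoring c') (s : Finset (X × Y))
    (hs : ∀ p ∈ s, ∀ q ∈ s, (p.1 = q.1 ↔ p.2 = q.2) ∧ (p.1 ≠ q.1 → c p.1 q.1 = c' p.2 q.2))
    (x : X) : ∃ y, ∀ p ∈ s, (p.1 = x ↔ p.2 = y) ∧ (p.1 ≠ x → c p.1 x = c' p.2 y) := by
  classical
  by_cases hx : ∃ p ∈ s, p.1 = x
  · obtain ⟨q, hq, rfl⟩ := hx
    exact ⟨q.2, fun p hp => hs p hp q hq⟩
  obtain ⟨y, hy, hyf⟩ := hc'.exists_realization (s.image Prod.snd)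
    (fun y => if h : ∃ p ∈ s, p.2 = y then c x h.choose.1 else c x x)
  refine ⟨y, fun p hp => ⟨⟨fun h => (hx ⟨p, hp, h⟩).elim, ?_⟩, fun _ => ?_⟩⟩
  · rintro rfl
    exact (hy (Finset.mem_image_of_mem _ hp)).elim
  · have h : ∃ q ∈ s, q.2 = p.2 := ⟨p, hp, rfl⟩
    have := hyf p.2 (Finset.mem_image_of_mem _ hp)
    rw [dif_pos h, (hs _ h.choose_spec.1 p hp).1.2 h.choose_spec.2] at this
    rw [hc, hc'.symm, this]

/-- A countable generic colouring is unique up to isomorphism and homogeneous: every finite partial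
isomorphism between two such colourings extends to an isomorphism. -/
theorem exists_equiv_extending [Countable X] [Countable Y] {c : X → X → C} {c' : Y → Y → C}
    (hc : IsGenericColoring c) (hc' : IsGenericColoring c') (s : Finset (X × Y))
    (hs : ∀ p ∈ s, ∀ q ∈ s, (p.1 = q.1 ↔ p.2 = q.2) ∧ (p.1 ≠ q.1 → c p.1 q.1 = c' p.2 q.2)) :
    ∃ e : X ≃ Y, (∀ p ∈ s, e p.1 = p.2) ∧ ∀ x x', x ≠ x' → c x x' = c' (e x) (e x') := by
  classical
  obtain ⟨e, he, h⟩ := exists_equiv_of_back_and_forth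
    (fun p q : X × Y => (p.1 = q.1 ↔ p.2 = q.2) ∧ (p.1 ≠ q.1 → c p.1 q.1 = c' p.2 q.2))
    (fun p => by simp)
    (fun p q h => ⟨by rw [eq_comm, h.1, eq_comm], fun hne => by
      rw [hc.symm, hc'.symm, h.2 hne.symm]⟩)
    (fun p q h => h.1) (exists_forth hc.symm hc')
    (fun s hs y => by
      obtain ⟨x, hx⟩ := exists_forth hc'.symm hc (s.image Prod.swap) (by
        simp only [Finset.forall_mem_image, Prod.fst_swap, Prod.snd_swap]
        intro p hp q hq
        have := hs p hp q hq
        exact ⟨this.1.symm, fun hne => (this.2 (mt this.1.1 hne)).symm⟩) y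
      simp only [Finset.forall_mem_image, Prod.fst_swap, Prod.snd_swap] at hx
      exact ⟨x, fun p hp => ⟨(hx hp).1.symm, fun hne => ((hx hp).2 (mt (hx hp).1.1 hne)).symm⟩⟩)
    s hs
  exact ⟨e, he, fun x x' => (h x x').2⟩

/-- Every finite coloured complete graph embeds into a generic colouring. -/
theorem exists_embedding [Finite Y] {c : X → X → C} (hc : IsGenericColoring c) (d : Y → Y → C)
    (hd : ∀ a b, d a b = d b a) :
    ∃ f : Y → X, Function.Injective f ∧ ∀ a b, a ≠ b → c (f a) (f b) = d a b := by
  classical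
  cases nonempty_fintype Y
  have key (s : Finset Y) : ∃ f : Y → X, Set.InjOn f s ∧
      ∀ a ∈ s, ∀ b ∈ s, a ≠ b → c (f a) (f b) = d a b := by
    induction s using Finset.induction_on with
    | empty =>
      obtain h | h := isEmpty_or_nonempty Y
      · exact ⟨fun a => (h.false a).elim, by simp, by simp⟩
      · obtain ⟨x, -⟩ := hc.exists_realization ∅ (fun _ => d h.some h.some)
        exact ⟨fun _ => x, by simp, by simp⟩
    | insert b s hb ih =>
      obtain ⟨f, hf, hfd⟩ := ih
      obtain ⟨x, hx, hxd⟩ := hc.exists_realization (s.image f)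
        (fun x => if h : ∃ a ∈ s, f a = x then d b h.choose else d b b)
      have hxb (a : Y) (ha : a ∈ s) : c x (f a) = d b a := by
        have h : ∃ a' ∈ s, f a' = f a := ⟨a, ha, rfl⟩
        rw [hxd _ (Finset.mem_image_of_mem f ha), dif_pos h,
          hf h.choose_spec.1 ha h.choose_spec.2]
      have hne (a : Y) (ha : a ∈ s) : a ≠ b := fun h => hb (h ▸ ha)
      refine ⟨Function.update f b x, ?_, ?_⟩
      · intro a ha a' ha' h
        rcases Finset.mem_insert.1 ha with rfl | hs <;>
          rcases Finset.mem_insert.1 ha' with rfl | hs'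
        · rfl
        · rw [Function.update_self, Function.update_of_ne (hne _ hs')] at h
          exact (hx (h ▸ Finset.mem_image_of_mem f hs')).elim
        · rw [Function.update_self, Function.update_of_ne (hne _ hs)] at h
          exact (hx (h ▸ Finset.mem_image_of_mem f hs)).elim
        · rw [Function.update_of_ne (hne _ hs), Function.update_of_ne (hne _ hs')] at h
          exact hf hs hs' h
      · intro a ha a' ha' h
        rcases Finset.mem_insert.1 ha with rfl | hs <;>
          rcases Finset.mem_insert.1 ha' with rfl | hs'
        · exact (h rfl).elim
        · rw [Function.update_self, Function.update_of_ne (hne _ hs'), hxb _ hs']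
        · rw [Function.update_self, Function.update_of_ne (hne _ hs), hc.symm, hxb _ hs, hd]
        · rw [Function.update_of_ne (hne _ hs), Function.update_of_ne (hne _ hs')]
          exact hfd _ hs _ hs' h
  obtain ⟨f, hf, hfd⟩ := key Finset.univ
  exact ⟨f, fun a b h => hf (by simp) (by simp) h, fun a b => hfd a (by simp) b (by simp)⟩

/-- Recolouring along a bijection of the colours preserves genericity. -/
theorem recolor {c : X → X → C} (hc : IsGenericColoring c) (α : C ≃ C) :
    IsGenericColoring (fun x y => α (c x y)) where
  symm x y := by rw [hc.symm]
  exists_realization A f := by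
    obtain ⟨x, hx, h⟩ := hc.exists_realization A (fun a => α.symm (f a))
    exact ⟨x, hx, fun a ha => by simp [h a ha]⟩

end IsGenericColoring

/-! ### The generic colouring on trees -/

/-- Trees with leaves in `ℕ`. The tree `graft t q s` should be thought of as the vertex obtained from
the vertex `s` by prescribing the colour `q` for the edge to `t`; thus a tree is a finite list of such
prescriptions, the first of which take precedence, ending in a natural number. -/
inductive ColorTree (C : Type u) : Type u
  | atom : ℕ → ColorTree C
  | graft : ColorTree C → C → ColorTree C → ColorTree C

namespace ColorTree

variable {C : Type u}

instance [Countable C] : Countable (ColorTree C) := by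
  obtain ⟨i, hi⟩ := exists_injective_nat C
  let code : ColorTree C → ℕ := fun t =>
    ColorTree.rec (fun n => 2 * n) (fun _ q _ a b => 2 * Nat.pair a (Nat.pair (i q) b) + 1) t
  refine (show Function.Injective code from fun t => ?_).countable
  induction t with
  | atom n =>
    rintro (m | ⟨t, q, s⟩) h
    · have h : 2 * n = 2 * m := h
      rw [show n = m by omega]
    · have h : 2 * n = 2 * Nat.pair (code t) (Nat.pair (i q) (code s)) + 1 := h
      omega
  | graft t q s iht ihs =>
    rintro (m | ⟨t', q', s'⟩) h
    · have h : 2 * Nat.pair (code t) (Nat.pair (i q) (code s)) + 1 = 2 * m := h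
      omega
    · have h : 2 * Nat.pair (code t) (Nat.pair (i q) (code s)) + 1 =
        2 * Nat.pair (code t') (Nat.pair (i q') (code s')) + 1 := h
      have h : Nat.pair (code t) (Nat.pair (i q) (code s)) =
        Nat.pair (code t') (Nat.pair (i q') (code s')) := by omega
      rw [Nat.pair_eq_pair, Nat.pair_eq_pair] at h
      rw [iht h.1, hi h.2.1, ihs h.2.2]

open Classical in
/-- The colour that the tree `x` prescribes for its edge to `y`, if any. -/
noncomputable def lookup : ColorTree C → ColorTree C → Option C
  | atom _, _ => none
  | graft t q s, y => if y = t then some q else lookup s y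

theorem sizeOf_lt_of_lookup {x y : ColorTree C} {q : C} (h : x.lookup y = some q) :
    sizeOf y < sizeOf x := by
  induction x with
  | atom n => simp [lookup] at h
  | graft t r s iht ihs =>
    rw [graft.sizeOf_spec]
    rw [lookup] at h
    split_ifs at h with hy
    · subst hy
      omega
    · have := ihs h
      omega

/-- The colouring in which an edge has the colour prescribed by one of its ends, and the colour `c₀`
if there is no such prescription. -/
noncomputable def color (c₀ : C) (x y : ColorTree C) : C :=
  ((x.lookup y).or (y.lookup x)).getD c₀

theorem color_comm (c₀ : C) (x y : ColorTree C) : color c₀ x y = color c₀ y x := by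
  unfold color
  -- At most one end of an edge prescribes its colour, as a prescribing tree is the larger one.
  cases hxy : x.lookup y <;> cases hyx : y.lookup x <;> try rfl
  have := sizeOf_lt_of_lookup hxy
  have := sizeOf_lt_of_lookup hyx
  omega

theorem isGenericColoring_color (c₀ : C) : IsGenericColoring (color c₀) where
  symm := color_comm c₀
  exists_realization A f := by
    classical
    have key : ∃ x : ColorTree C, ∀ a ∈ A, x.lookup a = some (f a) := by
      induction A using Finset.induction_on with
      | empty => exact ⟨atom 0, by simp⟩
      | insert b A _ ih =>
        obtain ⟨x, hx⟩ := ih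
        refine ⟨graft b (f b) x, fun a ha => ?_⟩
        rw [lookup]
        split_ifs with hab
        · rw [hab]
        · exact hx a (Finset.mem_of_mem_insert_of_ne ha hab)
    obtain ⟨x, hx⟩ := key
    exact ⟨x, fun h => (sizeOf_lt_of_lookup (hx x h)).false, fun a ha => by simp [color, hx a ha]⟩

/-- The action on trees of a self-map of the set of leaves. -/
def relabel (σ : ℕ → ℕ) : ColorTree C → ColorTree C
  | atom n => atom (σ n)
  | graft t q s => graft (relabel σ t) q (relabel σ s)

theorem relabel_id (t : ColorTree C) : relabel id t = t := by
  induction t with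
  | atom n => rfl
  | graft t q s iht ihs => rw [relabel, iht, ihs]

theorem relabel_comp (σ τ : ℕ → ℕ) (t : ColorTree C) :
    relabel (σ ∘ τ) t = relabel σ (relabel τ t) := by
  induction t with
  | atom n => rfl
  | graft t q s iht ihs => rw [relabel, iht, ihs, relabel, relabel]

/-- The action of the symmetric group on trees. -/
def permHom (C : Type u) : Equiv.Perm ℕ →* Equiv.Perm (ColorTree C) where
  toFun σ :=
    { toFun := relabel σ
      invFun := relabel σ.symm
      left_inv := fun t => by rw [← relabel_comp, Equiv.symm_comp_self, relabel_id]
      right_inv := fun t => by rw [← relabel_comp, Equiv.self_comp_symm, relabel_id] }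
  map_one' := Equiv.ext relabel_id
  map_mul' σ τ := Equiv.ext (relabel_comp σ τ)

theorem lookup_permHom (σ : Equiv.Perm ℕ) (x y : ColorTree C) :
    (permHom C σ x).lookup (permHom C σ y) = x.lookup y := by
  induction x with
  | atom n => rfl
  | graft t q s iht ihs =>
    change (graft (permHom C σ t) q (permHom C σ s)).lookup _ = _
    rw [lookup, lookup, ihs, (permHom C σ).injective.eq_iff]

theorem color_permHom (c₀ : C) (σ : Equiv.Perm ℕ) (x y : ColorTree C) :
    color c₀ (permHom C σ x) (permHom C σ y) = color c₀ x y := by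
  rw [color, lookup_permHom, lookup_permHom, color]

/-- Orbit maps of the action on trees are continuous, because a tree has only finitely many
leaves. -/
theorem continuous_permHom_apply [TopologicalSpace (ColorTree C)] [DiscreteTopology (ColorTree C)]
    (t : ColorTree C) : Continuous fun σ : Equiv.Perm ℕ => permHom C σ t := by
  induction t with
  | atom n =>
    let : TopologicalSpace ℕ := ⊥
    exact (continuous_of_discreteTopology (f := (atom : ℕ → ColorTree C))).comp
      ((continuous_apply n).comp continuous_induced_dom)
  | graft t q s iht ihs =>
    exact (continuous_of_discreteTopology
      (f := fun p : ColorTree C × ColorTree C => graft p.1 q p.2)).comp (iht.prodMk ihs)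

end ColorTree

/-! ### Echeloned spaces from colourings -/

namespace EchelonedSpace

/-- The echeloned space on `X` in which pairs are compared through their labels in a linear order;
the least label is that of the pairs on the diagonal. -/
def ofLabeling {X : Type u} [Nonempty X] {L : Type v} [LinearOrder L] [OrderBot L] (d : X → X → L)
    (hd : ∀ x y, d x y = ⊥ ↔ x = y) (hsymm : ∀ x y, d x y = d y x) : EchelonedSpace X where
  nonempty := inferInstance
  le p q := d p.1 p.2 ≤ d q.1 q.2
  le_refl _ := le_rfl
  le_trans _ _ _ := _root_.le_trans
  le_total _ _ := _root_.le_total _ _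
  diag_le x y z := by simp [(hd x x).2 rfl]
  eq_of_le_diag x y z h := by
    rw [← hd]
    exact le_bot_iff.1 (h.trans_eq ((hd x x).2 rfl))
  le_swap x y := (hsymm x y).le

open Classical in
/-- The label of a pair in a colouring with rational colours. -/
noncomputable def label {X : Type u} (c : X → X → ℚ) (x y : X) : WithBot ℚ :=
  if x = y then ⊥ else (c x y : WithBot ℚ)

section label

variable {X : Type u} {c : X → X → ℚ}

theorem label_eq_bot_iff (x y : X) : label c x y = ⊥ ↔ x = y := by
  unfold label
  split_ifs with h <;> simp [h]

theorem label_comm (hc : ∀ x y, c x y = c y x) (x y : X) : label c x y = label c y x := by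
  by_cases h : x = y
  · rw [h]
  · rw [label, label, if_neg h, if_neg (Ne.symm h), hc]

theorem label_of_ne {x y : X} (h : x ≠ y) : label c x y = c x y := if_neg h

/-- The echeloned space of a colouring with rational colours: edges are compared by colour. -/
noncomputable def ofColoring [Nonempty X] (c : X → X → ℚ) (hc : ∀ x y, c x y = c y x) :
    EchelonedSpace X :=
  ofLabeling (label c) label_eq_bot_iff (label_comm hc)

theorem ofColoring_le_iff [Nonempty X] (hc : ∀ x y, c x y = c y x) {x y x' y' : X} :
    (ofColoring c hc).le (x, y) (x', y') ↔ label c x y ≤ label c x' y' := Iff.rfl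

end label

theorem le_diag {X : Type u} (S : EchelonedSpace X) {x y : X} (p : X × X) (h : x = y) :
    S.le (x, y) p := by
  subst h
  exact S.diag_le _ _ _

theorem eq_of_le {X : Type u} (S : EchelonedSpace X) {x y : X} {p : X × X} (h : S.le p (x, y))
    (hxy : x = y) : p.1 = p.2 := by
  subst hxy
  exact S.eq_of_le_diag _ _ _ h

/-- The relation between pairs may be checked away from the diagonal. -/
theorem le_iff_le_of_offDiag {X : Type u} {Y : Type v} (S : EchelonedSpace X)
    (T : EchelonedSpace Y) {f : X → Y} (hf : Function.Injective f)
    (h : ∀ x y x' y', x ≠ y → x' ≠ y' →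
      (S.le (x, y) (x', y') ↔ T.le (f x, f y) (f x', f y'))) (x y x' y' : X) :
    S.le (x, y) (x', y') ↔ T.le (f x, f y) (f x', f y') := by
  by_cases hxy : x = y
  · exact iff_of_true (S.le_diag _ hxy) (T.le_diag _ (congrArg f hxy))
  by_cases hxy' : x' = y'
  · exact iff_of_false (fun h => hxy (S.eq_of_le h hxy'))
      (fun h => hxy (hf (T.eq_of_le h (congrArg f hxy'))))
  exact h x y x' y' hxy hxy'

/-- A finite echeloned space is given by its rank function: the number of pairs below a pair. -/
theorem exists_rank {A : Type u} [Finite A] (B : EchelonedSpace A) :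
    ∃ r : A → A → ℚ, ∀ x y x' y', B.le (x, y) (x', y') ↔ r x y ≤ r x' y' := by
  refine ⟨fun x y => ({p | B.le p (x, y)} : Set (A × A)).ncard, fun x y x' y' => ?_⟩
  rw [Nat.cast_le]
  refine ⟨fun h => Set.ncard_le_ncard (fun p hp => B.le_trans _ _ _ hp h), fun h => ?_⟩
  by_contra hn
  have hle := (B.le_total (x, y) (x', y')).resolve_left hn
  refine (Set.ncard_lt_ncard (t := {p | B.le p (x, y)}) ?_).not_ge h
  exact ⟨fun p hp => B.le_trans _ _ _ hp hle, fun hs => hn (hs (B.le_refl (x, y)))⟩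

section existence

variable {X : Type u} [Nonempty X] {c : X → X → ℚ}

theorem isUniversal_ofColoring (hc : IsGenericColoring c) :
    (ofColoring c hc.symm).IsUniversal := by
  intro A _ B
  obtain ⟨r, hr⟩ := B.exists_rank
  obtain ⟨f, hf, hfr⟩ := hc.exists_embedding r
    (fun a b => le_antisymm ((hr _ _ _ _).1 (B.le_swap a b)) ((hr _ _ _ _).1 (B.le_swap b a)))
  refine ⟨f, hf, B.le_iff_le_of_offDiag _ hf fun x y x' y' h h' => ?_⟩
  rw [hr, ofColoring_le_iff, label_of_ne (hf.ne h), label_of_ne (hf.ne h'), hfr _ _ h,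
    hfr _ _ h', WithBot.coe_le_coe]

theorem isHomogeneous_ofColoring [Countable X] (hc : IsGenericColoring c) :
    (ofColoring c hc.symm).IsHomogeneous := by
  classical
  intro A hAfin hA f hf
  obtain ⟨hfinj, hf⟩ := hf
  have := hAfin.fintype
  have hle {a b a' b' : A} (h : a ≠ b) (h' : a' ≠ b') :
      c a b ≤ c a' b' ↔ c (f a) (f b) ≤ c (f a') (f b') := by
    have := hf a b a' b'
    change label c a b ≤ label c a' b' ↔ label c (f a) (f b) ≤ label c (f a') (f b') at this
    rwa [label_of_ne (Subtype.coe_ne_coe.2 h), label_of_ne (Subtype.coe_ne_coe.2 h'),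
      label_of_ne (hfinj.ne h), label_of_ne (hfinj.ne h'), WithBot.coe_le_coe,
      WithBot.coe_le_coe] at this
  -- The map induced on the colours that occur in `A` extends to an automorphism `α` of `ℚ`. Then `f`
  -- is a finite partial isomorphism from the recolouring of `X` along `α` to `X`.
  obtain ⟨α, hα⟩ := exists_orderIso_rat_extending
    ((Finset.univ.filter fun p : A × A => p.1 ≠ p.2).image
      fun p => (c p.1 p.2, c (f p.1) (f p.2))) (by
    simp only [Finset.forall_mem_image, Finset.mem_filter, Finset.mem_univ, true_and]
    rintro ⟨a, b⟩ h ⟨a', b'⟩ h'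
    exact hle h h')
  simp only [Finset.forall_mem_image, Finset.mem_filter, Finset.mem_univ, true_and] at hα
  obtain ⟨e, he, hec⟩ := (hc.recolor α.toEquiv).exists_equiv_extending hc
    (Finset.univ.image fun a : A => ((a : X), f a)) (by
    simp only [Finset.forall_mem_image, Finset.mem_univ, true_implies]
    intro a b
    refine ⟨by rw [hfinj.eq_iff, Subtype.coe_inj], fun h => ?_⟩
    exact hα (x := (a, b)) (Subtype.coe_ne_coe.1 h))
  simp only [Finset.forall_mem_image, Finset.mem_univ, true_implies] at he
  refine ⟨e, le_iff_le_of_offDiag _ _ e.injective fun x y x' y' h h' => ?_, fun a => he (x := a)⟩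
  rw [ofColoring_le_iff, ofColoring_le_iff, label_of_ne h, label_of_ne h',
    label_of_ne (e.injective.ne h), label_of_ne (e.injective.ne h'), ← hec _ _ h, ← hec _ _ h',
    WithBot.coe_le_coe, WithBot.coe_le_coe]
  exact α.le_iff_le.symm

end existence

/-! ### The colouring of a universal homogeneous space -/

section coloring

variable {F : Type u} (E : EchelonedSpace F)

/-- Equivalence of pairs of distinct points: each is below the other. -/
def pairSetoid : Setoid {p : F × F // p.1 ≠ p.2} where
  r p q := E.le p q ∧ E.le q p
  iseqv := ⟨fun _ => ⟨E.le_refl _, E.le_refl _⟩, fun h => h.symm,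
    fun h h' => ⟨E.le_trans _ _ _ h.1 h'.1, E.le_trans _ _ _ h'.2 h.2⟩⟩

open Classical in
/-- The colour of an edge is its class under `pairSetoid`; the value `c₀` on the diagonal is
arbitrary. -/
noncomputable def pairColor (c₀ : Quotient E.pairSetoid) (x y : F) : Quotient E.pairSetoid :=
  if h : x = y then c₀ else Quotient.mk _ ⟨(x, y), h⟩

variable {E}

theorem pairColor_eq_mk_iff {c₀ : Quotient E.pairSetoid} {x y : F}
    (h : x ≠ y) (p : {p : F × F // p.1 ≠ p.2}) :
    pairColor E c₀ x y = Quotient.mk _ p ↔ E.le (x, y) p ∧ E.le p (x, y) := by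
  rw [pairColor, dif_neg h]
  exact Quotient.eq

theorem pairColor_comm (c₀ : Quotient E.pairSetoid) (x y : F) :
    pairColor E c₀ x y = pairColor E c₀ y x := by
  by_cases h : x = y
  · rw [h]
  · rw [pairColor.eq_def E c₀ y x, dif_neg (Ne.symm h), pairColor_eq_mk_iff h]
    exact ⟨E.le_swap _ _, E.le_swap _ _⟩

/-- An injective self-map that preserves the colours preserves the echelon. -/
theorem le_iff_le_of_pairColor_eq {c₀ : Quotient E.pairSetoid} {g : F → F}
    (hg : Function.Injective g)
    (h : ∀ x y, x ≠ y → pairColor E c₀ (g x) (g y) = pairColor E c₀ x y) (x y x' y' : F) :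
    E.le (x, y) (x', y') ↔ E.le (g x, g y) (g x', g y') := by
  refine E.le_iff_le_of_offDiag E hg (fun x y x' y' hne hne' => ?_) x y x' y'
  have key {x y : F} (hne : x ≠ y) : E.le (g x, g y) (x, y) ∧ E.le (x, y) (g x, g y) := by
    have := h x y hne
    rwa [pairColor.eq_def E c₀ x y, dif_neg hne, pairColor_eq_mk_iff (hg.ne hne)] at this
  exact ⟨fun hle => E.le_trans _ _ _ (key hne).1 (E.le_trans _ _ _ hle (key hne').2),
    fun hle => E.le_trans _ _ _ (key hne).2 (E.le_trans _ _ _ hle (key hne').1)⟩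

/-- The echeloned space on `B` in which pairs are compared through pairs of an echeloned space that
represent them. -/
def pullback {B : Type v} [Nonempty B] (E : EchelonedSpace F) (rep : B → B → F × F)
    (hrep : ∀ x y, (rep x y).1 = (rep x y).2 ↔ x = y) (hsymm : ∀ x y, E.le (rep x y) (rep y x)) :
    EchelonedSpace B where
  nonempty := inferInstance
  le p q := E.le (rep p.1 p.2) (rep q.1 q.2)
  le_refl _ := E.le_refl _
  le_trans _ _ _ := E.le_trans _ _ _
  le_total _ _ := E.le_total _ _
  diag_le x _ _ := E.le_diag _ ((hrep x x).2 rfl)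
  eq_of_le_diag x y z h := (hrep y z).1 (E.eq_of_le h ((hrep x x).2 rfl))
  le_swap := hsymm

/-- The extension property of a universal homogeneous space: over a finite set `A` there is a point
whose pairs with the points of `A` are equivalent to prescribed pairs of distinct points of `A`. -/
theorem exists_realization (hU : E.IsUniversal) (hH : E.IsHomogeneous) (A : Finset F)
    (hA : A.Nonempty) (f : A → A × A) (hf : ∀ a, (f a).1 ≠ (f a).2) :
    ∃ x ∉ A, ∀ a : A, E.le (x, a) ((f a).1, (f a).2) ∧ E.le ((f a).1, (f a).2) (x, a) := by
  classical
  let i : A ≃ Fin A.card := A.equivFin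
  obtain ⟨a₀, ha₀⟩ := hA
  -- The one-point extension of `A` with the prescribed pairs, on a type in the universe of `ℕ`.
  let rep : Option (Fin A.card) → Option (Fin A.card) → F × F := fun
    | none, none => (a₀, a₀)
    | none, some k => ((f (i.symm k)).1, (f (i.symm k)).2)
    | some k, none => ((f (i.symm k)).1, (f (i.symm k)).2)
    | some k, some l => (i.symm k, i.symm l)
  let B : EchelonedSpace (Option (Fin A.card)) := E.pullback rep
    (by rintro (_ | k) (_ | l) <;> simp [rep, hf])
    (by
      rintro (_ | k) (_ | l)
      · exact E.le_refl _
      · exact E.le_refl _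
      · exact E.le_refl _
      · exact E.le_swap _ _)
  obtain ⟨g, hg, hgB⟩ := hU _ B
  let j : A → F := fun a => g (some (i a))
  have hj : Function.Injective j := fun a b h => i.injective (Option.some_injective _ (hg h))
  let k : A ≃ Set.range j := Equiv.ofInjective j hj
  have hjE (a b a' b' : A) : E.le (a, b) (a', b') ↔ E.le (j a, j b) (j a', j b') := by
    rw [← hgB]
    change _ ↔ E.le (i.symm (i a), i.symm (i b)) (i.symm (i a'), i.symm (i b'))
    simp only [Equiv.symm_apply_apply]
  have hkj (b : Set.range j) : (b : F) = j (k.symm b) := (Equiv.apply_ofInjective_symm hj b).symm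
  -- Homogeneity moves the copy of `A` provided by universality back to `A`.
  obtain ⟨h, hh, hhk⟩ := hH (Set.range j) (Set.finite_range j) ⟨j ⟨a₀, ha₀⟩, _, rfl⟩
    (fun b => (k.symm b : A)) ⟨Subtype.val_injective.comp k.symm.injective, fun b₁ b₂ b₃ b₄ => by
      rw [hjE, ← hkj, ← hkj, ← hkj, ← hkj]
      rfl⟩
  have hhj (a : A) : h (j a) = a := by
    rw [show j a = k a from rfl, hhk, Equiv.symm_apply_apply]
  refine ⟨h (g none), fun hmem => ?_, fun a => ?_⟩
  · have := hhj ⟨_, hmem⟩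
    simpa using hg (h.injective this)
  · have h₁ : E.le (g none, j a) (j (f a).1, j (f a).2) := by
      rw [← hgB]
      change E.le ((f (i.symm (i a))).1, (f (i.symm (i a))).2) (i.symm (i _), i.symm (i _))
      simp only [Equiv.symm_apply_apply]
      exact E.le_refl _
    have h₂ : E.le (j (f a).1, j (f a).2) (g none, j a) := by
      rw [← hgB]
      change E.le (i.symm (i _), i.symm (i _)) ((f (i.symm (i a))).1, (f (i.symm (i a))).2)
      simp only [Equiv.symm_apply_apply]
      exact E.le_refl _
    rw [hh] at h₁ h₂
    simp only [hhj] at h₁ h₂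
    exact ⟨h₁, h₂⟩

theorem isGenericColoring_pairColor (hU : E.IsUniversal) (hH : E.IsHomogeneous)
    (c₀ : Quotient E.pairSetoid) : IsGenericColoring (pairColor E c₀) where
  symm := pairColor_comm c₀
  exists_realization A f := by
    classical
    -- The prescribed pairs are added to the finite set, so that the extension property applies.
    -- The new points get the colour `c₀`.
    let r : F → {p : F × F // p.1 ≠ p.2} := fun a => (f a).out
    let r₀ : {p : F × F // p.1 ≠ p.2} := c₀.out
    let A' : Finset F := insert r₀.1.1 (insert r₀.1.2
      (A ∪ (A.image (fun a => (r a).1.1) ∪ A.image (fun a => (r a).1.2))))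
    obtain ⟨x, hx, hxA⟩ := E.exists_realization hU hH A' ⟨_, Finset.mem_insert_self _ _⟩
      (fun a => if h : a.1 ∈ A then
          (⟨(r a).1.1, by simp [A']; grind⟩, ⟨(r a).1.2, by simp [A']; grind⟩)
        else (⟨r₀.1.1, by simp [A']⟩, ⟨r₀.1.2, by simp [A']⟩))
      (fun a => by
        split_ifs
        · exact fun h => (r a).2 (congrArg Subtype.val h)
        · exact fun h => r₀.2 (congrArg Subtype.val h))
    have hAA' : A ⊆ A' := fun a ha => by simp [A', ha]
    refine ⟨x, fun h => hx (hAA' h), fun a ha => ?_⟩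
    have hxa : x ≠ a := fun h => hx (h ▸ hAA' ha)
    have := hxA ⟨a, hAA' ha⟩
    simp only [dif_pos ha] at this
    rw [← Quotient.out_eq (f a), pairColor_eq_mk_iff hxa]
    exact this

theorem exists_ne (hU : E.IsUniversal) : ∃ x y : F, x ≠ y := by
  obtain ⟨f, hf, -⟩ := hU Bool (ofColoring (fun _ _ => 0) (fun _ _ => rfl))
  exact ⟨f false, f true, hf.ne (by simp)⟩

end coloring

/-! ### The embedding of the symmetric group -/

theorem exists_isEmbedding_perm_aut {F : Type u} [Countable F] (E : EchelonedSpace F)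
    (hU : E.IsUniversal) (hH : E.IsHomogeneous) :
    ∃ φ : Equiv.Perm ℕ →* E.aut, Topology.IsEmbedding φ := by
  obtain ⟨x₀, y₀, h₀⟩ := exists_ne hU
  let c₀ : Quotient E.pairSetoid := Quotient.mk _ ⟨(x₀, y₀), h₀⟩
  let T := ColorTree (Quotient E.pairSetoid)
  obtain ⟨e, -, he⟩ := (isGenericColoring_pairColor hU hH c₀).exists_equiv_extending
    (ColorTree.isGenericColoring_color c₀) ∅ (by simp)
  let act : Equiv.Perm ℕ →* Equiv.Perm F :=
    e.symm.permCongrHom.toMonoidHom.comp (ColorTree.permHom _)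
  have hact (σ : Equiv.Perm ℕ) (x : F) : act σ x = e.symm (ColorTree.permHom _ σ (e x)) := rfl
  have hmem (σ : Equiv.Perm ℕ) : act σ ∈ E.aut :=
    le_iff_le_of_pairColor_eq (c₀ := c₀) (act σ).injective fun x y h => by
      rw [he _ _ ((act σ).injective.ne h), he _ _ h, hact, hact, Equiv.apply_symm_apply,
        Equiv.apply_symm_apply, ColorTree.color_permHom]
  let : TopologicalSpace F := ⊥
  have : DiscreteTopology F := ⟨rfl⟩
  let : TopologicalSpace T := ⊥
  have : DiscreteTopology T := ⟨rfl⟩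
  let : TopologicalSpace ℕ := ⊥
  have : DiscreteTopology ℕ := ⟨rfl⟩
  let φ : Equiv.Perm ℕ →* E.aut := act.codRestrict E.aut hmem
  refine ⟨φ, ?_⟩
  have hφ : Continuous φ := by
    refine Continuous.subtype_mk (continuous_induced_rng.2 (continuous_pi fun x => ?_)) _
    exact continuous_of_discreteTopology.comp (ColorTree.continuous_permHom_apply (e x))
  -- A permutation is recovered continuously from its action on the vertices given by leaves.
  let ψ : E.aut → ℕ → T := fun g n => e (g.1 (e.symm (ColorTree.atom n)))
  have hψ : Continuous ψ := continuous_pi fun n =>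
    continuous_of_discreteTopology.comp
      ((continuous_apply _).comp (continuous_induced_dom.comp continuous_subtype_val))
  refine Topology.IsEmbedding.of_comp hφ hψ ?_
  have hψφ : ψ ∘ φ = (fun (u : ℕ → ℕ) n => (ColorTree.atom (u n) : T)) ∘
      fun (σ : Equiv.Perm ℕ) n => σ n := by
    funext σ n
    change e (e.symm (ColorTree.permHom _ σ (e (e.symm _)))) = _
    rw [Equiv.apply_symm_apply, Equiv.apply_symm_apply]
    rfl
  rw [hψφ]
  refine Topology.IsEmbedding.comp ?_ ⟨⟨rfl⟩, DFunLike.coe_injective⟩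
  exact Topology.IsEmbedding.piMap fun _ =>
    (Topology.IsClosedEmbedding.of_continuous_injective_isClosedMap continuous_of_discreteTopology
      (fun a b h => ColorTree.atom.inj h) (fun _ _ => isClosed_discrete _)).isEmbedding

end EchelonedSpace

theorem mainTheorem2 :
    (∃ (F : Type) (E : EchelonedSpace F), Countable F ∧ E.IsUniversal ∧ E.IsHomogeneous) ∧
    ∀ (F : Type u) (E : EchelonedSpace F), Countable F → E.IsUniversal → E.IsHomogeneous →
      ∃ φ : Equiv.Perm ℕ →* E.aut, Topology.IsEmbedding φ := by
  have : Nonempty (ColorTree ℚ) := ⟨ColorTree.atom 0⟩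
  have hc := ColorTree.isGenericColoring_color (0 : ℚ)
  exact ⟨⟨ColorTree ℚ, EchelonedSpace.ofColoring _ hc.symm, inferInstance,
    EchelonedSpace.isUniversal_ofColoring hc, EchelonedSpace.isHomogeneous_ofColoring hc⟩,
    fun F E _ hU hH => E.exists_isEmbedding_perm_aut hU hH⟩
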